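/- Let $p$ be a prime and $r\ge 1$. For a nonnegative integer $n$ let $\sigma_p(n)$ be the sum of its base-$p$ digits. Let $D\subset\mathbb{N}^r$ be a finite set not contained in any coordinate hyperplane, i.e. for each $1\le j\le r$ some $d=(d_1,\dots,d_r)\in D$ has $d_j\ne 0$. For $m\ge 1$ let $E_D(m)$ be the set of nonzero families $U=(u_d)_{d\in D}$ of integers $0\le u_d\le p^m-1$ such that $$\sum_{d\in D}u_d\,d_j\equiv 0 \pmod{p^m-1}\quad\text{and}\quad \sum_{d\in D}u_d\,d_j>0\qquad\text{for all }1\le j\le r,$$ and put $$\sigma_p(D,m)=\min_{U\in E_D(m)}\ \sum_{d\in D}\sigma_p(u_d),\qquad \pi_p(D)=\frac1{p-1}\min_{m\ge 1}\frac{\sigma_p(D,m)}{m}$$ (the $p$-density of $D$). For a finite field $\mathbb{F}_q$ of characteristic $p$, a nontrivial additive character $\psi$ of $\mathbb{F}_q$ with values in $\mathbb{C}_p$, and $f\in\mathbb{F}_q[x_1,\dots,x_r]$, let $$S_q(f)=\sum_{x\in\mathbb{F}_q^r}\psi(f(x)),$$ and let $v_q$ be the valuation of $\mathbb{C}_p$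 normalized by $v_q(q)=1$, with $v_q(0)=\infty$. (1) Let $f\in\mathbb{F}_q[x_1,\dots,x_r]$ be a polynomial in which all the variables $x_1,\dots,x_r$ actually appear, and let $D$ be the set of exponents of the monomials occurring in $f$. Then, for every nontrivial $\psi$, $$v_q(S_q(f))\ge \pi_p(D).$$ (2) This inequality is optimal: for every $p$ and $D$ as above there is a power $q=p^m$, $m\ge 1$, such that for every nontrivial additive character $\psi$ of $\mathbb{F}_q$ there is a polynomial $f$ over $\mathbb{F}_q$, all of whose exponents lie in $D$, with $$v_q(S_q(f))=\pi_p(D).$$ -/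

import Mathlib

/-- The `p`-weight of a natural number: the sum of its base-`p` digits. -/
def pWeight (p n : ℕ) : ℕ := (Nat.digits p n).sum

/-- The set `E_D(m)` of nonzero families `u = (u_d)_{d ∈ D}` with entries in `{0, …, p ^ m - 1}`
such that every coordinate of `∑ u_d d` is positive and divisible by `p ^ m - 1`. -/
def modularSolutions (p : ℕ) {r : ℕ} (D : Finset (Fin r →₀ ℕ)) (m : ℕ) : Set (D → ℕ) :=
  {u | (∀ d, u d ≤ p ^ m - 1) ∧ u ≠ 0 ∧
    (∀ j : Fin r, ∑ d, u d * (d : Fin r →₀ ℕ) j ≡ 0 [MOD p ^ m - 1]) ∧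
    ∀ j : Fin r, 0 < ∑ d, u d * (d : Fin r →₀ ℕ) j}

/-- `σ_p(D, m)`: the least total `p`-weight of an element of `E_D(m)`. -/
noncomputable def minWeight (p : ℕ) {r : ℕ} (D : Finset (Fin r →₀ ℕ)) (m : ℕ) : ℕ :=
  sInf ((fun u : D → ℕ => ∑ d, pWeight p (u d)) '' modularSolutions p D m)

/-- The `p`-density `π_p(D)`: `1 / (p - 1)` times the minimum of `σ_p(D, m) / m` over `m ≥ 1`. -/
noncomputable def pDensity (p : ℕ) {r : ℕ} (D : Finset (Fin r →₀ ℕ)) : ℝ :=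
  1 / ((p : ℝ) - 1) * sInf {x : ℝ | ∃ m : ℕ, 1 ≤ m ∧ x = (minWeight p D m : ℝ) / (m : ℝ)}

/-- The exponential sum `∑ ψ (f x)` over all `x ∈ F ^ r`. -/
noncomputable def expSum {F R : Type*} [Field F] [Fintype F] [CommRing R] {r : ℕ}
    (ψ : AddChar F R) (f : MvPolynomial (Fin r) F) : R :=
  ∑ x : Fin r → F, ψ (MvPolynomial.eval x f)

open Classical in
/-- The `q`-adic valuation on `ℂ_[p]`, for `q` a power of `p`: it is `∞` at `0`, and is normalized
by `v_q(q) = 1` (the norm of `ℂ_[p]` satisfies `‖p‖ = 1 / p`). -/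
noncomputable def qAdicVal {p : ℕ} [Fact p.Prime] (q : ℕ) (x : PadicComplex p) : WithTop ℝ :=
  if x = 0 then ⊤ else ((-Real.logb q ‖x‖ : ℝ) : WithTop ℝ)

/-- The minimum defining `σ_p(D, m)` is over a nonempty set as soon as `r ≥ 1`, `m ≥ 1` and no
coordinate vanishes on all of `D`. -/
theorem modularSolutions_nonempty {p : ℕ} (hp : p.Prime) {r : ℕ} (hr : 0 < r)
    (D : Finset (Fin r →₀ ℕ)) (hD : ∀ j : Fin r, ∃ d ∈ D, d j ≠ 0) {m : ℕ} (hm : 1 ≤ m) :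
    (modularSolutions p D m).Nonempty := by
  have hq : 0 < p ^ m - 1 := Nat.sub_pos_of_lt (Nat.one_lt_pow (by omega) hp.one_lt)
  refine ⟨fun _ => p ^ m - 1, fun _ => le_rfl, ?_, fun j => ?_, fun j => ?_⟩
  · obtain ⟨d, hd, -⟩ := hD ⟨0, hr⟩
    exact fun h => hq.ne' (congrFun h ⟨d, hd⟩)
  · rw [← Finset.mul_sum]
    exact (Nat.modEq_zero_iff_dvd).2 (Dvd.intro _ rfl)
  · obtain ⟨d, hd, hj⟩ := hD j
    exact Finset.sum_pos' (fun _ _ => Nat.zero_le _)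
      ⟨⟨d, hd⟩, Finset.mem_univ _, Nat.mul_pos hq (Nat.pos_of_ne_zero hj)⟩

/-! Fix `F` of order `q = p ^ m` and let `ρ = p ^ (-1 / (p - 1))`. Interpolate `ψ x = ∑_{i < q} c_i
T(x) ^ i`, with `T` the Teichmüller character. Up to a unit `c_i` is a Gauss sum (the ends `i = 0, q
- 1` are explicit), and a weak Stickelberger theorem gives `‖c_i‖ = ρ ^ σ_p(i)`. Summing over `x`
turns the sum of `∑ a_d x ^ d` into a polynomial in the `T (a_d)`. Its coefficient at `u` vanishes
unless `q - 1` divides every `∑ u_d d_j`, and then has norm `ρ` to the total weight of `u`, plus `m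
(p - 1)` for each zero coordinate. `minWeight_le_add` absorbs this surplus, so every sum has norm at
most `ρ ^ σ_p(D, m)`.

The bound is sharp for each `m`: by duality the coefficient at a minimal `u` is a combination, with
coefficients of norm at most 1, of the sums over all choices of `a`. By the ultrametric inequality
one of these sums is as large as that coefficient.

It remains to find an `m` minimizing `σ_p(D, m) / m`. By pigeonhole on the cyclic rotations of its
digits, a long solution splits into two shorter ones (`exists_split`), so only boundedly many `m`
matter. -/

theorem pWeight_mul_add {p b c : ℕ} (hp : 1 < p) (hc : c < p) :
    pWeight p (p * b + c) = pWeight p b + c := by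
  unfold pWeight
  by_cases h : c ≠ 0 ∨ b ≠ 0
  · rw [add_comm (p * b), Nat.digits_add p hp c b hc h, List.sum_cons, add_comm]
  · push Not at h
    simp [h.1, h.2]

theorem pWeight_zero (p : ℕ) : pWeight p 0 = 0 := by simp [pWeight]

theorem pWeight_mul_pow_add {p : ℕ} (hp : 1 < p) (a : ℕ) {n b : ℕ} (hb : b < p ^ n) :
    pWeight p (a * p ^ n + b) = pWeight p a + pWeight p b := by
  induction n generalizing b with
  | zero =>
    obtain rfl : b = 0 := by simpa using hb
    simp [pWeight_zero]
  | succ n ih =>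
    have hc : b % p < p := Nat.mod_lt _ (by omega)
    have hb' : b / p < p ^ n := Nat.div_lt_of_lt_mul (by rwa [pow_succ'] at hb)
    have e : b = p * (b / p) + b % p := (Nat.div_add_mod b p).symm
    have e' : a * p ^ (n + 1) + b = p * (a * p ^ n + b / p) + b % p := by
      conv_lhs => rw [e]
      ring
    rw [e', pWeight_mul_add hp hc, ih hb', add_assoc, ← pWeight_mul_add hp hc, ← e]

theorem pWeight_pow_sub_one {p : ℕ} (hp : 1 < p) (m : ℕ) :
    pWeight p (p ^ m - 1) = m * (p - 1) := by
  induction m with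
  | zero => simp [pWeight_zero]
  | succ m ih =>
    have h1 : 1 ≤ p ^ m := Nat.one_le_pow _ _ (by omega)
    have e : p ^ (m + 1) - 1 = p * (p ^ m - 1) + (p - 1) := by
      rw [pow_succ', Nat.mul_sub, mul_one]
      have : p ≤ p * p ^ m := Nat.le_mul_of_pos_right p h1
      omega
    rw [e, pWeight_mul_add hp (by omega), ih]
    ring

/-- Cyclic rotation by `i` places of the word of `m` base-`p` digits of `u`. -/
def rotateDigits (p m i u : ℕ) : ℕ := p ^ i * (u % p ^ (m - i)) + u / p ^ (m - i)

/-! ### Solutions as cyclic words of digits; the density is attained -/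

section Density

variable {p r : ℕ} {D : Finset (Fin r →₀ ℕ)}

theorem mem_modularSolutions_iff (hp : 1 < p) (hr : 0 < r) {m : ℕ} (hm : 1 ≤ m) {u : D → ℕ} :
    u ∈ modularSolutions p D m ↔ (∀ d, u d ≤ p ^ m - 1) ∧
      ∀ j : Fin r, ∃ s : ℕ, 0 < s ∧
        ∑ d, u d * (d : Fin r →₀ ℕ) j = (p ^ m - 1) * s := by
  have hq : 0 < p ^ m - 1 := Nat.sub_pos_of_lt (Nat.one_lt_pow (by omega) hp)
  constructor
  · rintro ⟨h1, -, h3, h4⟩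
    refine ⟨h1, fun j => ?_⟩
    obtain ⟨s, hs⟩ := (Nat.modEq_zero_iff_dvd).1 (h3 j)
    refine ⟨s, Nat.pos_of_ne_zero ?_, hs⟩
    rintro rfl
    exact (h4 j).ne' (hs.trans (mul_zero _))
  · rintro ⟨h1, h2⟩
    refine ⟨h1, ?_, fun j => ?_, fun j => ?_⟩
    · rintro rfl
      obtain ⟨s, hs, e⟩ := h2 ⟨0, hr⟩
      simp only [Pi.zero_apply, zero_mul, Finset.sum_const_zero] at e
      have := Nat.mul_pos hq hs
      omega
    · obtain ⟨s, -, e⟩ := h2 j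
      exact (Nat.modEq_zero_iff_dvd).2 ⟨s, e⟩
    · obtain ⟨s, hs, e⟩ := h2 j
      rw [e]
      exact Nat.mul_pos hq hs

theorem minWeight_le {m : ℕ} {u : D → ℕ} (hu : u ∈ modularSolutions p D m) :
    minWeight p D m ≤ ∑ d, pWeight p (u d) := Nat.sInf_le ⟨u, hu, rfl⟩

theorem exists_weight_eq_minWeight (hp : p.Prime) (hr : 0 < r)
    (hD : ∀ j : Fin r, ∃ d ∈ D, d j ≠ 0) {m : ℕ} (hm : 1 ≤ m) :
    ∃ u ∈ modularSolutions p D m, ∑ d, pWeight p (u d) = minWeight p D m :=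
  Nat.sInf_mem ((modularSolutions_nonempty hp hr D hD hm).image _)

/-- Moving the top `i` digits to the bottom replaces `p ^ m` by `1`, so rotation is multiplication
by `p ^ i` modulo `p ^ m - 1`. -/
theorem rotateDigits_add {m i : ℕ} (hp : 1 < p) (hi : i ≤ m) (u : ℕ) :
    rotateDigits p m i u + (p ^ m - 1) * (u / p ^ (m - i)) = p ^ i * u := by
  have h1 : 1 ≤ p ^ m := Nat.one_le_pow _ _ (by omega)
  have e : p ^ m = p ^ i * p ^ (m - i) := by rw [← pow_add]; congr 1; omega
  have e2 := Nat.div_add_mod u (p ^ (m - i))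
  unfold rotateDigits
  zify [h1] at *
  rw [e]
  linear_combination (p : ℤ) ^ i * e2

theorem rotateDigits_le {m i u : ℕ} (hp : 1 < p) (hi : i ≤ m) (hu : u ≤ p ^ m - 1) :
    rotateDigits p m i u ≤ p ^ m - 1 := by
  have h1 : 1 ≤ p ^ m := Nat.one_le_pow _ _ (by omega)
  have h2 : 0 < p ^ (m - i) := Nat.pow_pos (by omega)
  have e : p ^ m = p ^ i * p ^ (m - i) := by rw [← pow_add]; congr 1; omega
  have ha : u / p ^ (m - i) < p ^ i := Nat.div_lt_of_lt_mul (by rw [mul_comm, ← e]; omega)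
  have hb : u % p ^ (m - i) + 1 ≤ p ^ (m - i) := Nat.mod_lt _ h2
  have := Nat.mul_le_mul_left (p ^ i) hb
  unfold rotateDigits
  rw [mul_add, ← e] at this
  omega

theorem rotateDigits_pos {m i u : ℕ} (hp : 1 < p) (hu : 0 < u) : 0 < rotateDigits p m i u := by
  by_contra! h
  obtain ⟨h1, h2⟩ := Nat.add_eq_zero_iff.1 (Nat.le_zero.1 h)
  have h3 := Nat.div_add_mod u (p ^ (m - i))
  rcases Nat.mul_eq_zero.1 h1 with h | h
  · exact absurd h (Nat.pow_pos (by omega)).ne'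
  · rw [h, h2] at h3
    simp at h3
    omega

/-- Rotation preserves the congruences and keeps nonzero entries nonzero. As entries are at most `p
^ m - 1`, the quotients lie in a box independent of `m` and `i`, ready for pigeonhole. -/
theorem exists_rotation_quotients (hp : 1 < p) {m : ℕ} (hm : 1 ≤ m) {u : D → ℕ}
    (hu : u ∈ modularSolutions p D m) {i : ℕ} (hi : i ≤ m) :
    ∃ s : Fin r → ℕ,
      (∀ j, s j ∈ Finset.Icc 1 (∑ d : D, (d : Fin r →₀ ℕ) j)) ∧
      ∀ j, ∑ d, rotateDigits p m i (u d) * (d : Fin r →₀ ℕ) j = (p ^ m - 1) * s j := by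
  have hq : 0 < p ^ m - 1 := Nat.sub_pos_of_lt (Nat.one_lt_pow (by omega) hp)
  have key : ∀ j : Fin r, ∃ s : ℕ, s ∈ Finset.Icc 1 (∑ d : D, (d : Fin r →₀ ℕ) j) ∧
      ∑ d, rotateDigits p m i (u d) * (d : Fin r →₀ ℕ) j = (p ^ m - 1) * s := by
    intro j
    have hdvd : p ^ m - 1 ∣ ∑ d, rotateDigits p m i (u d) * (d : Fin r →₀ ℕ) j := by
      have h1 : ∑ d, rotateDigits p m i (u d) * (d : Fin r →₀ ℕ) j +
          (p ^ m - 1) * ∑ d, u d / p ^ (m - i) * (d : Fin r →₀ ℕ) j =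
          p ^ i * ∑ d, u d * (d : Fin r →₀ ℕ) j := by
        rw [Finset.mul_sum, Finset.mul_sum, ← Finset.sum_add_distrib]
        refine Finset.sum_congr rfl fun d _ => ?_
        rw [← mul_assoc, ← mul_assoc, ← add_mul, rotateDigits_add hp hi]
      have h2 := (Nat.modEq_zero_iff_dvd).1 (hu.2.2.1 j)
      exact (Nat.dvd_add_left (Dvd.intro _ rfl)).1 (h1 ▸ h2.mul_left _)
    obtain ⟨s, hs⟩ := hdvd
    refine ⟨s, Finset.mem_Icc.2 ⟨Nat.pos_of_ne_zero ?_, ?_⟩, hs⟩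
    · rintro rfl
      obtain ⟨d, -, hd⟩ := Finset.exists_ne_zero_of_sum_ne_zero (hu.2.2.2 j).ne'
      have h0 : rotateDigits p m i (u d) * (d : Fin r →₀ ℕ) j = 0 :=
        (Finset.sum_eq_zero_iff.1 (hs.trans (mul_zero _))) d (Finset.mem_univ _)
      have := rotateDigits_pos (m := m) (i := i) hp
        (Nat.pos_of_ne_zero (left_ne_zero_of_mul hd))
      rcases Nat.mul_eq_zero.1 h0 with h | h
      · omega
      · exact right_ne_zero_of_mul hd h
    · refine Nat.le_of_mul_le_mul_left ?_ hq
      rw [← hs, Finset.mul_sum]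
      exact Finset.sum_le_sum fun d _ => Nat.mul_le_mul_right _ (rotateDigits_le hp hi (hu.1 d))
  choose s hs using key
  exact ⟨s, fun j => (hs j).1, fun j => (hs j).2⟩

/-- A solution on more digits than there are quotient vectors is a juxtaposition of two shorter
solutions. -/
theorem exists_split (hp : 1 < p) (hr : 0 < r) {m : ℕ} (hm : 1 ≤ m) {u : D → ℕ}
    (hu : u ∈ modularSolutions p D m)
    (hlt : ∏ j : Fin r, ∑ d : D, (d : Fin r →₀ ℕ) j < m) :
    ∃ n n' : ℕ, 1 ≤ n ∧ 1 ≤ n' ∧ n + n' = m ∧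
      ∃ v ∈ modularSolutions p D n, ∃ v' ∈ modularSolutions p D n',
        ∑ d, pWeight p (v d) + ∑ d, pWeight p (v' d) = ∑ d, pWeight p (u d) := by
  choose s hs hse using fun i : Fin m => exists_rotation_quotients hp hm hu i.2.le
  have hcard : (Fintype.piFinset fun j : Fin r =>
      Finset.Icc 1 (∑ d : D, (d : Fin r →₀ ℕ) j)).card < (Finset.univ : Finset (Fin m)).card := by
    simpa [Fintype.card_piFinset] using hlt
  obtain ⟨x, -, y, -, hxy, hsxy⟩ := Finset.exists_ne_map_eq_of_card_lt_of_maps_to hcard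
    (f := s) (fun i _ => Fintype.mem_piFinset.2 (hs i))
  wlog hlt' : x < y generalizing x y
  · exact this y x hxy.symm hsxy.symm (lt_of_le_of_ne (not_lt.1 hlt') hxy.symm)
  obtain ⟨i, hi⟩ := x
  obtain ⟨i', hi'⟩ := y
  have hii : i < i' := hlt'
  obtain ⟨l, rfl⟩ := Nat.exists_eq_add_of_lt hii
  obtain ⟨n, hn⟩ := Nat.exists_eq_add_of_lt hi'
  set L := l + 1 with hL
  set M := n + 1 with hM
  have hmi : m - i = M + L := by omega
  have hmi' : m - (i + l + 1) = M := by omega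
  have hm' : m = i + L + M := by omega
  have hP : ∀ k, 1 ≤ p ^ k := fun k => Nat.one_le_pow _ _ (by omega)
  have hA : ∀ d, u d / p ^ (M + L) < p ^ i := fun d => Nat.div_lt_of_lt_mul <| by
    have := hu.1 d
    have := hP m
    rw [← pow_add, show M + L + i = m by omega]
    omega
  have hB : ∀ d, u d % p ^ (M + L) / p ^ M < p ^ L := fun d => Nat.div_lt_of_lt_mul <| by
    rw [← pow_add]
    exact Nat.mod_lt _ (hP _)
  have hC : ∀ d, u d % p ^ M < p ^ M := fun d => Nat.mod_lt _ (hP _)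
  have hBC : ∀ d, u d % p ^ (M + L) = u d % p ^ (M + L) / p ^ M * p ^ M + u d % p ^ M := fun d => by
    conv_lhs => rw [← Nat.div_add_mod (u d % p ^ (M + L)) (p ^ M)]
    rw [Nat.mod_mod_of_dvd _ (pow_dvd_pow p (Nat.le_add_right _ _)), mul_comm]
  have hABC : ∀ d, u d = u d / p ^ (M + L) * p ^ (M + L) + u d % p ^ (M + L) := fun d => by
    rw [mul_comm, Nat.div_add_mod]
  have hAB : ∀ d, u d / p ^ M = u d / p ^ (M + L) * p ^ L + u d % p ^ (M + L) / p ^ M := fun d => by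
    have h1 : u d = p ^ M * (u d / p ^ (M + L) * p ^ L + u d % p ^ (M + L) / p ^ M)
        + u d % p ^ M := by
      conv_lhs => rw [hABC d, hBC d]
      ring
    conv_lhs => rw [h1]
    rw [Nat.mul_add_div (hP M), Nat.div_eq_of_lt (hC d), add_zero]
  obtain ⟨-, hs0⟩ := (mem_modularSolutions_iff hp hr hm).1 hu
  choose t ht hte using hs0
  -- Each `u d` is the word `ABC` with blocks of `i`, `L`, `M` digits. The rotations `BCA` and `CAB`
  -- have the same quotients `s`. Since `p ^ L * BCA - CAB = (p ^ m - 1) * B`, the block `B` is a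
  -- solution on `L` digits with quotients `s`; the remaining word `AC` is one on `i + M` digits
  -- with the quotients `t` of `u`.
  set A : D → ℕ := fun d => u d / p ^ (M + L)
  set B : D → ℕ := fun d => u d % p ^ (M + L) / p ^ M
  set C : D → ℕ := fun d => u d % p ^ M
  have hX : ∀ d, rotateDigits p m i (u d) = p ^ i * (B d * p ^ M + C d) + A d := fun d => by
    rw [rotateDigits, hmi, hBC d]
  have hY : ∀ d, rotateDigits p m (i + l + 1) (u d) =
      p ^ (i + L) * C d + (A d * p ^ L + B d) := fun d => by
    rw [rotateDigits, hmi', hAB d, add_assoc i]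
  have hQ' : ((p : ℤ) ^ m - 1) ≠ 0 := by
    have : 1 < p ^ m := Nat.one_lt_pow (by omega) hp
    have : (1 : ℤ) < (p : ℤ) ^ m := by exact_mod_cast this
    omega
  have sumu : ∀ j : Fin r, (∑ d, (u d : ℤ) * ((d : Fin r →₀ ℕ) j : ℤ)) = ((p : ℤ) ^ m - 1) * t j := by
    intro j
    have := hte j
    zify [hP m] at this
    exact this
  have sumx : ∀ j : Fin r, (∑ d, ((p : ℤ) ^ i * (B d * (p : ℤ) ^ M + C d) + A d) *
      ((d : Fin r →₀ ℕ) j : ℤ)) = ((p : ℤ) ^ m - 1) * s ⟨i, hi⟩ j := by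
    intro j
    have := hse ⟨i, hi⟩ j
    simp only [hX] at this
    zify [hP m] at this
    exact_mod_cast this
  have sumy : ∀ j : Fin r, (∑ d, ((p : ℤ) ^ (i + L) * C d + (A d * (p : ℤ) ^ L + B d)) *
      ((d : Fin r →₀ ℕ) j : ℤ)) = ((p : ℤ) ^ m - 1) * s ⟨i, hi⟩ j := by
    intro j
    have := hse ⟨i + l + 1, hi'⟩ j
    rw [← hsxy] at this
    simp only [hY] at this
    zify [hP m] at this
    exact_mod_cast this
  have sumB : ∀ j : Fin r, (∑ d, (B d : ℤ) * ((d : Fin r →₀ ℕ) j : ℤ)) =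
      ((p : ℤ) ^ L - 1) * s ⟨i, hi⟩ j := by
    intro j
    refine mul_left_cancel₀ hQ' ?_
    have e : (∑ d, ((p : ℤ) ^ (i + L) * C d + (A d * (p : ℤ) ^ L + B d)) *
        ((d : Fin r →₀ ℕ) j : ℤ)) + ((p : ℤ) ^ m - 1) *
          (∑ d, (B d : ℤ) * ((d : Fin r →₀ ℕ) j : ℤ)) =
        (p : ℤ) ^ L * (∑ d, ((p : ℤ) ^ i * (B d * (p : ℤ) ^ M + C d) + A d) *
          ((d : Fin r →₀ ℕ) j : ℤ)) := by
      rw [Finset.mul_sum, Finset.mul_sum, ← Finset.sum_add_distrib]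
      refine Finset.sum_congr rfl fun d _ => ?_
      rw [hm']
      ring
    rw [sumx, sumy] at e
    linear_combination e
  have sumA : ∀ j : Fin r, (∑ d, (A d : ℤ) * ((d : Fin r →₀ ℕ) j : ℤ)) =
      (p : ℤ) ^ i * t j - s ⟨i, hi⟩ j := by
    intro j
    refine mul_left_cancel₀ hQ' ?_
    have e : (∑ d, ((p : ℤ) ^ i * (B d * (p : ℤ) ^ M + C d) + A d) *
        ((d : Fin r →₀ ℕ) j : ℤ)) + ((p : ℤ) ^ m - 1) *
          (∑ d, (A d : ℤ) * ((d : Fin r →₀ ℕ) j : ℤ)) =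
        (p : ℤ) ^ i * ∑ d, (u d : ℤ) * ((d : Fin r →₀ ℕ) j : ℤ) := by
      rw [Finset.mul_sum, Finset.mul_sum, ← Finset.sum_add_distrib]
      refine Finset.sum_congr rfl fun d _ => ?_
      have h : (u d : ℤ) = A d * (p : ℤ) ^ (M + L) + (B d * (p : ℤ) ^ M + C d) := by
        exact_mod_cast (hABC d).trans (by rw [hBC d])
      rw [h, hm']
      ring
    rw [sumx, sumu] at e
    linear_combination e
  have sumAC : ∀ j : Fin r, (∑ d, ((A d : ℤ) * (p : ℤ) ^ M + C d) * ((d : Fin r →₀ ℕ) j : ℤ)) =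
      ((p : ℤ) ^ (i + M) - 1) * t j := by
    intro j
    have e : (∑ d, ((A d : ℤ) * (p : ℤ) ^ M + C d) * ((d : Fin r →₀ ℕ) j : ℤ)) +
        ((p : ℤ) ^ (M + L) - (p : ℤ) ^ M) * (∑ d, (A d : ℤ) * ((d : Fin r →₀ ℕ) j : ℤ)) +
        (p : ℤ) ^ M * (∑ d, (B d : ℤ) * ((d : Fin r →₀ ℕ) j : ℤ)) =
        ∑ d, (u d : ℤ) * ((d : Fin r →₀ ℕ) j : ℤ) := by
      rw [Finset.mul_sum, Finset.mul_sum, ← Finset.sum_add_distrib, ← Finset.sum_add_distrib]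
      refine Finset.sum_congr rfl fun d _ => ?_
      have h : (u d : ℤ) = A d * (p : ℤ) ^ (M + L) + (B d * (p : ℤ) ^ M + C d) := by
        exact_mod_cast (hABC d).trans (by rw [hBC d])
      rw [h]
      ring
    rw [sumA, sumB, sumu] at e
    have hpm : (p : ℤ) ^ m = p ^ i * p ^ L * p ^ M := by rw [hm', pow_add, pow_add]
    rw [pow_add] at e ⊢
    linear_combination e + (t j : ℤ) * hpm
  refine ⟨L, i + M, by omega, by omega, by omega, B,
    (mem_modularSolutions_iff hp hr (by omega)).2 ⟨fun d => Nat.le_sub_one_of_lt (hB d),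
      fun j => ⟨s ⟨i, hi⟩ j, (Finset.mem_Icc.1 (hs _ j)).1, ?_⟩⟩,
    fun d => A d * p ^ M + C d,
    (mem_modularSolutions_iff hp hr (by omega)).2 ⟨fun d => Nat.le_sub_one_of_lt ?_,
      fun j => ⟨t j, ht j, ?_⟩⟩, ?_⟩
  · zify [hP L]
    exact sumB j
  · calc A d * p ^ M + C d < A d * p ^ M + p ^ M := Nat.add_lt_add_left (hC d) _
      _ = (A d + 1) * p ^ M := by ring
      _ ≤ p ^ i * p ^ M := Nat.mul_le_mul_right _ (hA d)
      _ = p ^ (i + M) := (pow_add _ _ _).symm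
  · zify [hP (i + M)]
    exact sumAC j
  · rw [← Finset.sum_add_distrib]
    refine Finset.sum_congr rfl fun d _ => ?_
    rw [pWeight_mul_pow_add hp _ (hC d)]
    conv_rhs => rw [hABC d, pWeight_mul_pow_add hp _ (Nat.mod_lt _ (hP _)), hBC d,
      pWeight_mul_pow_add hp _ (hC d)]
    ring

/-- The weight-to-length ratio of a juxtaposition is a mediant of those of its parts, so one part
does no worse; descend on the length. -/
theorem exists_bounded_ratio_le (hp : p.Prime) (hr : 0 < r)
    (hD : ∀ j : Fin r, ∃ d ∈ D, d j ≠ 0) {m : ℕ} (hm : 1 ≤ m) :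
    ∃ n : ℕ, 1 ≤ n ∧ n ≤ 1 + ∏ j : Fin r, ∑ d : D, (d : Fin r →₀ ℕ) j ∧
      (minWeight p D n : ℝ) / n ≤ (minWeight p D m : ℝ) / m := by
  induction m using Nat.strong_induction_on with
  | _ m ih =>
    by_cases hle : m ≤ 1 + ∏ j : Fin r, ∑ d : D, (d : Fin r →₀ ℕ) j
    · exact ⟨m, hm, hle, le_rfl⟩
    obtain ⟨u, hu, hw⟩ := exists_weight_eq_minWeight hp hr hD hm
    obtain ⟨n, n', hn, hn', hnn, v, hv, v', hv', hvv⟩ :=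
      exists_split hp.one_lt hr hm hu (by omega)
    have h : (minWeight p D n : ℝ) + minWeight p D n' ≤ minWeight p D m := by
      have := minWeight_le hv
      have := minWeight_le hv'
      exact_mod_cast (show minWeight p D n + minWeight p D n' ≤ minWeight p D m by omega)
    have h0 : (0 : ℝ) < n := by exact_mod_cast hn
    have h0' : (0 : ℝ) < n' := by exact_mod_cast hn'
    have hm0 : (m : ℝ) = n + n' := by exact_mod_cast hnn.symm
    have hcase : (minWeight p D n : ℝ) / n ≤ (minWeight p D m : ℝ) / m ∨
        (minWeight p D n' : ℝ) / n' ≤ (minWeight p D m : ℝ) / m := by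
      by_contra! hc
      obtain ⟨h1, h2⟩ := hc
      rw [lt_div_iff₀ h0] at h1
      rw [lt_div_iff₀ h0'] at h2
      have h3 : (minWeight p D m : ℝ) / m * m = minWeight p D m :=
        div_mul_cancel₀ _ (by positivity)
      rw [hm0] at h1 h2 h3
      nlinarith
    rcases hcase with hc | hc
    · obtain ⟨k, hk, hk', hk''⟩ := ih n (by omega) hn
      exact ⟨k, hk, hk', hk''.trans hc⟩
    · obtain ⟨k, hk, hk', hk''⟩ := ih n' (by omega) hn'
      exact ⟨k, hk, hk', hk''.trans hc⟩

theorem pDensity_le (hp : p.Prime) {m : ℕ} (hm : 1 ≤ m) :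
    pDensity p D ≤ 1 / ((p : ℝ) - 1) * (minWeight p D m / m) := by
  have : (1 : ℝ) < p := by exact_mod_cast hp.one_lt
  refine mul_le_mul_of_nonneg_left (csInf_le ⟨0, ?_⟩ ⟨m, hm, rfl⟩)
    (one_div_nonneg.2 (by linarith))
  rintro x ⟨n, -, rfl⟩
  positivity

/-- The infimum in the definition of the `p`-density is attained. -/
theorem exists_pDensity_eq (hp : p.Prime) (hr : 0 < r) (hD : ∀ j : Fin r, ∃ d ∈ D, d j ≠ 0) :
    ∃ m : ℕ, 1 ≤ m ∧ pDensity p D = 1 / ((p : ℝ) - 1) * (minWeight p D m / m) := by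
  obtain ⟨m, hm, hmin⟩ := Finset.exists_min_image
    (Finset.Icc 1 (1 + ∏ j : Fin r, ∑ d : D, (d : Fin r →₀ ℕ) j))
    (fun n => (minWeight p D n : ℝ) / n) ⟨1, by simp⟩
  have hleast : IsLeast {x : ℝ | ∃ n : ℕ, 1 ≤ n ∧ x = (minWeight p D n : ℝ) / (n : ℝ)}
      (minWeight p D m / m) := by
    refine ⟨⟨m, (Finset.mem_Icc.1 hm).1, rfl⟩, ?_⟩
    rintro x ⟨n, hn, rfl⟩
    obtain ⟨k, hk, hk', hk''⟩ := exists_bounded_ratio_le hp hr hD hn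
    exact (hmin k (Finset.mem_Icc.2 ⟨hk, hk'⟩)).trans hk''
  exact ⟨m, (Finset.mem_Icc.1 hm).1, by rw [pDensity, hleast.csInf_eq]⟩

/-- A solution of the congruences some of whose coordinates vanish becomes a member of `E_D(m)` at
the cost of at most `m (p - 1)` for each vanishing coordinate. -/
theorem minWeight_le_add (hp : p.Prime) (hr : 0 < r) (hD : ∀ j : Fin r, ∃ d ∈ D, d j ≠ 0)
    {m : ℕ} (hm : 1 ≤ m) {u : D → ℕ} (hu : ∀ d, u d ≤ p ^ m - 1)
    (hdvd : ∀ j : Fin r, p ^ m - 1 ∣ ∑ d, u d * (d : Fin r →₀ ℕ) j) :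
    minWeight p D m ≤ ∑ d, pWeight p (u d) + m * (p - 1) *
      (Finset.univ.filter fun j : Fin r => ∑ d, u d * (d : Fin r →₀ ℕ) j = 0).card := by
  classical
  choose f hfD hf using hD
  have hq : 0 < p ^ m - 1 := Nat.sub_pos_of_lt (Nat.one_lt_pow (by omega) hp.one_lt)
  set J := Finset.univ.filter fun j : Fin r => ∑ d, u d * (d : Fin r →₀ ℕ) j = 0 with hJ
  -- For each vanishing coordinate `j`, the entry at `f j` is zero; raising it to `p ^ m - 1` costs
  -- `m (p - 1)`. One exponent may serve several `j`, whence only an inequality.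
  set I : Finset D := J.image fun j => ⟨f j, hfD j⟩ with hI
  have hI0 : ∀ d ∈ I, u d = 0 := by
    intro d hd
    obtain ⟨j, hj, rfl⟩ := Finset.mem_image.1 hd
    have := Finset.sum_eq_zero_iff.1 (Finset.mem_filter.1 hj).2 ⟨f j, hfD j⟩ (Finset.mem_univ _)
    exact (Nat.mul_eq_zero.1 this).resolve_right (hf j)
  set v : D → ℕ := fun d => u d + if d ∈ I then p ^ m - 1 else 0 with hv
  have hsum : ∀ j : Fin r, ∑ d, v d * (d : Fin r →₀ ℕ) j =
      ∑ d, u d * (d : Fin r →₀ ℕ) j + (p ^ m - 1) * ∑ d ∈ I, (d : Fin r →₀ ℕ) j := by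
    intro j
    simp only [hv, add_mul, Finset.sum_add_distrib, ite_mul, zero_mul, Finset.mul_sum]
    rw [← Finset.sum_filter, Finset.filter_univ_mem]
  have hmem : v ∈ modularSolutions p D m := by
    refine (mem_modularSolutions_iff hp.one_lt hr hm).2 ⟨fun d => ?_, fun j => ?_⟩
    · by_cases hd : d ∈ I
      · simp [hv, hd, hI0 d hd]
      · simpa [hv, hd] using hu d
    · obtain ⟨s, hs⟩ := hdvd j
      refine ⟨s + ∑ d ∈ I, (d : Fin r →₀ ℕ) j, ?_, by rw [hsum, hs, mul_add]⟩
      by_cases hj : j ∈ J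
      · have : 0 < ∑ d ∈ I, (d : Fin r →₀ ℕ) j :=
          Finset.sum_pos' (fun _ _ => Nat.zero_le _)
            ⟨⟨f j, hfD j⟩, Finset.mem_image_of_mem _ hj, Nat.pos_of_ne_zero (hf j)⟩
        omega
      · have : s ≠ 0 := by
          rintro rfl
          exact hj (Finset.mem_filter.2 ⟨Finset.mem_univ _, hs⟩)
        omega
  have hcard : I.card ≤ J.card := Finset.card_image_le
  calc minWeight p D m ≤ ∑ d, pWeight p (v d) := minWeight_le hmem
    _ = ∑ d, (pWeight p (u d) + if d ∈ I then m * (p - 1) else 0) := by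
        refine Finset.sum_congr rfl fun d _ => ?_
        by_cases hd : d ∈ I
        · simp [hv, hd, hI0 d hd, pWeight_zero, pWeight_pow_sub_one hp.one_lt]
        · simp [hv, hd]
    _ = ∑ d, pWeight p (u d) + m * (p - 1) * I.card := by
        rw [Finset.sum_add_distrib, ← Finset.sum_filter, Finset.filter_univ_mem, Finset.sum_const,
          smul_eq_mul, mul_comm I.card]
    _ ≤ _ := by gcongr

end Density

theorem norm_eq_one_of_pow_eq_one {K : Type*} [NormedField K] {x : K} {n : ℕ} (hn : n ≠ 0)
    (h : x ^ n = 1) : ‖x‖ = 1 :=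
  (pow_eq_one_iff_of_nonneg (norm_nonneg x) hn).1 (by rw [← norm_pow, h, norm_one])

/-! ### Teichmüller lifts in the unit ball of `K` -/

section Teichmuller

open IsLocalRing

/-- The ring of elements of norm at most `1` in a nonarchimedean normed field. -/
noncomputable abbrev unitBallRing (K : Type*) [NormedField K] [IsUltrametricDist K] : ValuationSubring K :=
  (NormedField.valuation (K := K)).valuationSubring

variable {K : Type*} [NormedField K] [IsUltrametricDist K]

theorem norm_coe_unitBallRing_le (x : unitBallRing K) : ‖(x : K)‖ ≤ 1 := x.2

theorem residue_eq_zero_iff_norm_lt_one (x : unitBallRing K) :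
    residue (unitBallRing K) x = 0 ↔ ‖(x : K)‖ < 1 := by
  rw [residue_eq_zero_iff, Valuation.mem_maximalIdeal_iff, NormedField.valuation_apply,
    ← NNReal.coe_lt_coe]
  rfl

theorem norm_eq_one_of_residue_ne_zero {x : unitBallRing K}
    (hx : residue (unitBallRing K) x ≠ 0) : ‖(x : K)‖ = 1 :=
  le_antisymm (norm_coe_unitBallRing_le x)
    (not_lt.1 fun h => hx ((residue_eq_zero_iff_norm_lt_one x).2 h))

theorem charP_residueField {p : ℕ} (hp : p.Prime) (hpK : ‖(p : K)‖ < 1) :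
    CharP (ResidueField (unitBallRing K)) p := by
  have h0 : (p : ResidueField (unitBallRing K)) = 0 := by
    rw [← map_natCast (residue (unitBallRing K)), residue_eq_zero_iff_norm_lt_one]
    simpa using hpK
  have h1 := (Nat.dvd_prime hp).1 (ringChar.dvd h0)
  exact ringChar.of_eq (h1.resolve_left CharP.ringChar_ne_one)

/-- A root in `K` of a monic lift is integral over the unit ball, which is integrally closed, so it
can be reduced. -/
theorem isAlgClosed_residueField [IsAlgClosed K] :
    IsAlgClosed (ResidueField (unitBallRing K)) := by
  refine IsAlgClosed.of_exists_root _ fun f hf hirr => ?_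
  obtain ⟨g, rfl, hdeg, hg⟩ := Polynomial.lifts_and_natDegree_eq_and_monic
    ((Polynomial.mem_lifts f).2 (Polynomial.map_surjective _ residue_surjective f)) hf
  obtain ⟨x, hx⟩ := IsAlgClosed.exists_aeval_eq_zero K g
    (by rw [Polynomial.degree_eq_natDegree hg.ne_zero, hdeg]
        exact_mod_cast hirr.natDegree_pos.ne')
  obtain ⟨y, rfl⟩ := IsIntegrallyClosed.isIntegral_iff.1 (⟨g, hg, hx⟩ : IsIntegral (unitBallRing K) x)
  refine ⟨residue _ y, ?_⟩
  rw [Polynomial.aeval_algebraMap_apply, Polynomial.coe_aeval_eq_eval] at hx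
  rw [Polynomial.eval_map_apply, (FaithfulSMul.algebraMap_injective (unitBallRing K) K)
    (hx.trans (map_zero _).symm), map_zero]

/-- The Teichmüller character of a finite field, relative to an embedding of it in the residue
field. -/
theorem exists_teichmuller [IsAlgClosed K] [CharZero K] {p : ℕ} [Fact p.Prime]
    (hpK : ‖(p : K)‖ < 1) (F : Type*) [Field F] [Fintype F] [CharP F p] :
    ∃ (χ : MulChar F (unitBallRing K)) (σ : F →+* ResidueField (unitBallRing K)),
      ∀ x, residue (unitBallRing K) (χ x) = σ x := by
  classical
  set k := ResidueField (unitBallRing K)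
  have : CharP k p := charP_residueField Fact.out hpK
  have : IsAlgClosed k := isAlgClosed_residueField
  let := ZMod.algebra F p
  let := ZMod.algebra k p
  let σ : F →ₐ[ZMod p] k := IsAlgClosed.lift
  set n := Fintype.card F - 1 with hn
  have hn1 : n + 1 = Fintype.card F := Nat.sub_add_cancel Fintype.card_pos
  have hn0 : n ≠ 0 := by have := Fintype.one_lt_card (α := F); omega
  have : NeZero n := ⟨hn0⟩
  have hnk : (n : k) ≠ 0 := by
    have h : ((n + 1 : ℕ) : k) = 0 := by
      rw [hn1, ← map_natCast σ, FiniteField.cast_card_eq_zero, map_zero]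
    intro h'
    rw [Nat.cast_add, h', zero_add, Nat.cast_one] at h
    exact one_ne_zero h
  -- Reduction is a bijection on `n`-th roots of unity, and the lift is its inverse. It is injective
  -- because `ζ ≠ 1` reducing to `1` would turn `1 + ζ + ⋯ + ζ ^ (n - 1) = 0` into `n = 0` in `k`;
  -- surjectivity is a count.
  let red := restrictRootsOfUnity (residue (unitBallRing K)) n
  have hinj : Function.Injective red := by
    rw [injective_iff_map_eq_one]
    intro ζ hζ
    have h1 : residue (unitBallRing K) (ζ : (unitBallRing K)ˣ) = 1 := by
      have := congrArg (fun z : rootsOfUnity n k => ((z : kˣ) : k)) hζ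
      simpa [red] using this
    have h2 : (((ζ : (unitBallRing K)ˣ) : unitBallRing K)) ^ n = 1 := by
      simpa using congrArg Units.val ((mem_rootsOfUnity n _).1 ζ.2)
    have h3 := mul_geom_sum ((ζ : (unitBallRing K)ˣ) : unitBallRing K) n
    rw [h2, sub_self, mul_eq_zero] at h3
    rcases h3 with h3 | h3
    · ext
      simpa using congrArg Subtype.val (sub_eq_zero.1 h3)
    · exfalso
      have := congrArg (residue (unitBallRing K)) h3
      simp only [map_sum, map_pow, h1, one_pow, Finset.sum_const, Finset.card_range, map_zero,
        nsmul_eq_mul, mul_one] at this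
      exact hnk this
  have hbij : Function.Bijective red := by
    refine hinj.bijective_of_nat_card_le ((card_rootsOfUnity k n).trans ?_)
    obtain ⟨ζ, hζ⟩ := HasEnoughRootsOfUnity.exists_primitiveRoot K n
    have hζ1 : ‖ζ‖ = 1 := norm_eq_one_of_pow_eq_one hn0 hζ.pow_eq_one
    have hζ' : IsPrimitiveRoot (⟨ζ, hζ1.le⟩ : unitBallRing K) n :=
      IsPrimitiveRoot.of_map_of_injective (f := (unitBallRing K).subtype) hζ
        Subtype.val_injective
    exact hζ'.card_rootsOfUnity.ge
  let e := MulEquiv.ofBijective red hbij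
  let τ : Fˣ →* rootsOfUnity n k := (Units.map (σ : F →* k)).codRestrict _ fun u => by
    rw [mem_rootsOfUnity, ← map_pow, hn, ← Fintype.card_units, pow_card_eq_one, map_one]
  refine ⟨MulChar.ofUnitHom ((rootsOfUnity n (unitBallRing K)).subtype.comp
    (e.symm.toMonoidHom.comp τ)), σ, fun x => ?_⟩
  by_cases hx : x = 0
  · simp [hx, MulChar.map_zero]
  · obtain ⟨u, rfl⟩ := (Ne.isUnit hx)
    rw [MulChar.ofUnitHom_coe]
    exact congrArg (fun z : rootsOfUnity n k => ((z : kˣ) : k)) (e.apply_symm_apply (τ u))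

end Teichmuller

/-! ### Absolute values of Gauss sums -/

section GaussSumNorm

open Finset

theorem MulChar.pow_eq_one_iff_of_injective {F R : Type*} [Field F] [Fintype F] [CommRing R]
    {χ : MulChar F R} (hχ : Function.Injective χ) {a : ℕ} :
    χ ^ a = 1 ↔ Fintype.card F - 1 ∣ a := by
  constructor
  · intro h
    obtain ⟨g, hg⟩ := IsCyclic.exists_generator (α := Fˣ)
    rw [← Nat.card_eq_fintype_card, ← Nat.card_units,
      ← orderOf_eq_card_of_forall_mem_zpowers hg, orderOf_dvd_iff_pow_eq_one]
    refine Units.ext (hχ ?_)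
    rw [Units.val_pow_eq_pow_val, map_pow, ← MulChar.pow_apply_coe, h, MulChar.one_apply_coe,
      Units.val_one, MulChar.map_one]
  · rintro ⟨c, rfl⟩
    ext u
    rw [MulChar.pow_apply_coe, pow_mul, ← map_pow,
      FiniteField.pow_card_sub_one_eq_one _ u.ne_zero, MulChar.map_one, one_pow,
      MulChar.one_apply_coe]

/-- The Jacobi sum over `F` of the `F`-valued characters `x ↦ x⁻ᵃ` and `x ↦ x⁻¹`. -/
theorem jacobiSum_inv_pow {F : Type*} [Field F] [Fintype F] {η : MulChar F F}
    (hη : ∀ x, η x = x⁻¹) {a : ℕ} (ha : a + 1 < Fintype.card F - 1) :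
    jacobiSum (η ^ a) η = -((a : F) + 1) := by
  classical
  have hinj : Function.Injective η := by
    have : (η : F → F) = fun x => x⁻¹ := funext hη
    rw [this]
    exact inv_injective
  induction a with
  | zero =>
    have : η ≠ 1 := by
      rw [← pow_one η, Ne, MulChar.pow_eq_one_iff_of_injective hinj]
      exact Nat.not_dvd_of_pos_of_lt one_pos (by omega)
    rw [pow_zero, jacobiSum_one_nontrivial this]
    simp
  | succ a ih =>
    have hne : η ^ (a + 1) ≠ 1 := by
      rw [Ne, MulChar.pow_eq_one_iff_of_injective hinj]
      exact Nat.not_dvd_of_pos_of_lt a.succ_pos (by omega)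
    -- Away from `0` and `1` the summands differ by `x⁻¹ ^ (a + 1)`, whose sum over all nonzero `x`
    -- is zero; only the missing `x = 1` remains.
    have h1 : jacobiSum (η ^ (a + 1)) η - jacobiSum (η ^ a) η = -1 := by
      have h2 : ∀ x ∈ univ \ {(0 : F), 1}, (η ^ (a + 1)) x * η (1 - x) - (η ^ a) x * η (1 - x) =
          (η ^ (a + 1)) x := by
        intro x hx
        simp only [mem_sdiff, mem_univ, mem_insert, mem_singleton, not_or, true_and] at hx
        obtain ⟨u, rfl⟩ := Ne.isUnit hx.1
        have h3 : 1 - (u : F) ≠ 0 := sub_ne_zero.2 (Ne.symm hx.2)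
        rw [MulChar.pow_apply_coe, MulChar.pow_apply_coe, hη, hη]
        have hu := mul_inv_cancel₀ hx.1
        have hz := mul_inv_cancel₀ h3
        linear_combination (u : F)⁻¹ ^ (a + 1) * hz + (u : F)⁻¹ ^ a * (1 - (u : F))⁻¹ * hu
      rw [jacobiSum_eq_sum_sdiff, jacobiSum_eq_sum_sdiff, ← sum_sub_distrib, sum_congr rfl h2]
      have h4 := MulChar.sum_eq_zero_of_ne_one hne
      rw [← sum_sdiff (subset_univ {(0 : F), 1}), sum_pair zero_ne_one, MulChar.map_zero,
        MulChar.map_one] at h4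
      linear_combination h4
    rw [ih (by omega)] at h1
    push_cast
    linear_combination h1

/-- Linear independence of characters allows at most `|F|` of them, and the shifts of `ψ` already
give that many. -/
theorem AddChar.exists_mulShift_eq {F K : Type*} [Field F] [Fintype F] [Field K]
    {ψ : AddChar F K} (hψ : ψ ≠ 1) (φ : AddChar F K) : ∃ a : F, ψ.mulShift a = φ := by
  have li : LinearIndependent K (fun f : Multiplicative F →* K => (f : Multiplicative F → K)) :=
    linearIndependent_monoidHom (Multiplicative F) K
  have hfin : Finite (Multiplicative F →* K) := li.finite
  have hcard : Nat.card (Multiplicative F →* K) ≤ Nat.card F := by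
    have := Fintype.ofFinite (Multiplicative F →* K)
    have := li.fintype_card_le_finrank
    rw [Module.finrank_fintype_fun_eq_card, Fintype.card_multiplicative] at this
    rwa [Nat.card_eq_fintype_card, Nat.card_eq_fintype_card]
  have : Finite (AddChar F K) := Finite.of_equiv _ AddChar.toMonoidHomEquiv.symm
  rw [← Nat.card_congr (AddChar.toMonoidHomEquiv (A := F) (M := K))] at hcard
  exact ((AddChar.to_mulShift_inj_of_isPrimitive
    (AddChar.IsPrimitive.of_ne_one hψ)).bijective_of_nat_card_le hcard).2 φ

variable {K : Type*} [NormedField K] {F : Type*} [Field F] [Fintype F]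

theorem MulChar.norm_apply_of_ne_zero (χ : MulChar F K) {x : F} (hx : x ≠ 0) : ‖χ x‖ = 1 :=
  norm_eq_one_of_pow_eq_one (n := Fintype.card F - 1)
    (by have := Fintype.one_lt_card (α := F); omega)
    (by rw [← map_pow, FiniteField.pow_card_sub_one_eq_one x hx, MulChar.map_one])

theorem MulChar.norm_apply_le (χ : MulChar F K) (x : F) : ‖χ x‖ ≤ 1 := by
  by_cases hx : x = 0
  · simp [hx]
  · exact (χ.norm_apply_of_ne_zero hx).le

theorem norm_gaussSum_eq_of_ne_one (χ : MulChar F K) {ψ φ : AddChar F K} (hψ : ψ ≠ 1)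
    (hφ : φ ≠ 1) : ‖gaussSum χ ψ‖ = ‖gaussSum χ φ‖ := by
  obtain ⟨a, rfl⟩ := AddChar.exists_mulShift_eq hψ φ
  have ha : a ≠ 0 := by
    rintro rfl
    exact hφ (AddChar.mulShift_zero ψ)
  have := gaussSum_mulShift χ ψ (Units.mk0 a ha)
  rw [← this, norm_mul, Units.val_mk0, χ.norm_apply_of_ne_zero ha, one_mul]

/-- Substituting along Frobenius moves the `p`-th power from `χ` to `ψ`, and the norm does not
depend on the nontrivial `ψ`. -/
theorem norm_gaussSum_pow_char {p : ℕ} [Fact p.Prime] [CharP F p] (χ : MulChar F K)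
    {ψ : AddChar F K} (hψ : ψ ≠ 1) : ‖gaussSum (χ ^ p) ψ‖ = ‖gaussSum χ ψ‖ := by
  let e := frobeniusEquiv F p
  let φ : AddChar F K := ψ.compAddMonoidHom e.symm.toAddEquiv.toAddMonoidHom
  have hφ : φ ≠ 1 := by
    intro h
    refine hψ (DFunLike.ext _ _ fun x => ?_)
    have := DFunLike.congr_fun h (e x)
    simpa [φ] using this
  have h : gaussSum (χ ^ p) ψ = gaussSum χ φ := by
    refine Fintype.sum_equiv e.toEquiv _ _ fun x => ?_
    rw [MulChar.pow_apply' χ (Fact.out : p.Prime).ne_zero, ← map_pow]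
    simp [φ, e, frobenius_def]
  rw [h, norm_gaussSum_eq_of_ne_one χ hφ hψ]

/-- Gauss sums of powers of `ω` in terms of that of `ω`, provided the Jacobi sums that intervene
are units. -/
theorem norm_gaussSum_pow_eq {p : ℕ} [Fact p.Prime] [CharP F p] {ω : MulChar F K}
    (hω : Function.Injective ω)
    (hJ : ∀ a, a + 1 < Fintype.card F - 1 → ¬ p ∣ a + 1 → ‖jacobiSum (ω ^ a) ω‖ = 1)
    {ψ : AddChar F K} (hψ : ψ ≠ 1) {a : ℕ} (ha : a < Fintype.card F - 1) :
    ‖gaussSum (ω ^ a) ψ‖ = ‖gaussSum ω ψ‖ ^ pWeight p a := by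
  have hp : p.Prime := Fact.out
  induction a using Nat.strong_induction_on with
  | _ a ih =>
    rcases Nat.eq_zero_or_pos a with rfl | hpos
    · simp [pWeight_zero, gaussSum_one_left hψ]
    -- A final digit zero is removed by Frobenius without changing the weight. Otherwise a Jacobi
    -- sum of norm one lowers the last digit, and the weight, by one.
    by_cases hdvd : p ∣ a
    · obtain ⟨b, rfl⟩ := hdvd
      have hb : b < p * b := by nlinarith [hp.two_le, Nat.pos_of_mul_pos_left hpos]
      have hw : pWeight p (p * b) = pWeight p b := pWeight_mul_add (c := 0) hp.one_lt hp.pos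
      rw [mul_comm p b, pow_mul, norm_gaussSum_pow_char _ hψ, ih b hb (hb.trans ha), mul_comm, hw]
    · obtain ⟨b, rfl⟩ : ∃ b, a = b + 1 := ⟨a - 1, by omega⟩
      have hne : ω ^ b * ω ≠ 1 := by
        rw [← pow_succ, Ne, MulChar.pow_eq_one_iff_of_injective hω]
        exact Nat.not_dvd_of_pos_of_lt b.succ_pos ha
      have h := congrArg norm (jacobiSum_mul_nontrivial hne ψ)
      have hmod : (b + 1) % p ≠ 0 := fun h => hdvd (Nat.dvd_of_mod_eq_zero h)
      have hlt := Nat.mod_lt (b + 1) hp.pos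
      have hw : pWeight p (b + 1) = pWeight p b + 1 := by
        have e := Nat.div_add_mod (b + 1) p
        have e' : b = p * ((b + 1) / p) + ((b + 1) % p - 1) := by omega
        have h1 := pWeight_mul_add (b := (b + 1) / p) hp.one_lt hlt
        have h2 := pWeight_mul_add (b := (b + 1) / p) (c := (b + 1) % p - 1) hp.one_lt (by omega)
        rw [e] at h1
        rw [← e'] at h2
        omega
      rw [norm_mul, norm_mul, hJ b ha hdvd, mul_one, ih b (by omega) (by omega)] at h
      rw [pow_succ, h, hw, pow_succ]

/-- The absolute values of Gauss sums (a weak form of Stickelberger's theorem). -/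
theorem norm_gaussSum_pow_eq_pow_pWeight {p : ℕ} [Fact p.Prime] [CharP F p] {ρ : ℝ} (hρ0 : 0 ≤ ρ)
    (hρ : ρ ^ (p - 1) = ‖(p : K)‖) {ω : MulChar F K} (hω : Function.Injective ω)
    (hJ : ∀ a, a + 1 < Fintype.card F - 1 → ¬ p ∣ a + 1 → ‖jacobiSum (ω ^ a) ω‖ = 1)
    {ψ : AddChar F K} (hψ : ψ ≠ 1) {a : ℕ} (ha : a < Fintype.card F - 1) :
    ‖gaussSum (ω ^ a) ψ‖ = ρ ^ pWeight p a := by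
  have hp : p.Prime := Fact.out
  rw [norm_gaussSum_pow_eq hω hJ hψ ha]
  rcases Nat.eq_zero_or_pos a with rfl | hpos
  · simp [pWeight_zero]
  obtain ⟨m, hm, hcard⟩ := FiniteField.card F p
  obtain ⟨k, hk⟩ : ∃ k, (m : ℕ) = k + 1 := ⟨m - 1, by have := m.pos; omega⟩
  rw [hk] at hcard
  set n := Fintype.card F - 1 with hn
  -- All digits of `q - 2` are `p - 1` except the last, `p - 2`. Hence the product of the Gauss sums
  -- of `ω` and `ω⁻¹`, which is `q`, determines the norm of the first.
  have hw : pWeight p (n - 1) + 1 = (k + 1) * (p - 1) := by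
    have h1 : 1 ≤ p ^ k := Nat.one_le_pow _ _ hp.pos
    have e : n - 1 = p * (p ^ k - 1) + (p - 2) := by
      rw [hn, hcard, pow_succ', Nat.mul_sub, mul_one]
      have : p ≤ p * p ^ k := Nat.le_mul_of_pos_right p h1
      have := hp.two_le
      omega
    rw [e, pWeight_mul_add hp.one_lt (by have := hp.pos; omega), pWeight_pow_sub_one hp.one_lt,
      add_mul]
    have := hp.two_le
    omega
  have hω1 : ω ≠ 1 := by
    rw [← pow_one ω, Ne, MulChar.pow_eq_one_iff_of_injective hω]
    exact Nat.not_dvd_of_pos_of_lt one_pos (by omega)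
  have hinv : ω⁻¹ = ω ^ (n - 1) := by
    rw [inv_eq_iff_mul_eq_one, ← pow_succ', MulChar.pow_eq_one_iff_of_injective hω]
    exact dvd_of_eq (by omega)
  have hψ' : ψ⁻¹ ≠ 1 := inv_ne_one.2 hψ
  have h := congrArg norm (gaussSum_mul_gaussSum_eq_card hω1 (AddChar.IsPrimitive.of_ne_one hψ))
  rw [norm_mul, hinv, norm_gaussSum_pow_eq hω hJ hψ' (by omega : n - 1 < n),
    norm_gaussSum_eq_of_ne_one ω hψ' hψ, ← pow_succ', hw, hcard, Nat.cast_pow, norm_pow, ← hρ,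
    ← pow_mul, mul_comm (p - 1)] at h
  have hne : (k + 1) * (p - 1) ≠ 0 :=
    Nat.mul_ne_zero k.succ_ne_zero (Nat.sub_ne_zero_of_lt hp.one_lt)
  rw [(pow_left_inj₀ (norm_nonneg _) hρ0 hne).1 h]

end GaussSumNorm

/-! ### Interpolating additive characters by powers of `T` -/

section Dual

open Finset

/-- The case `e = 0` stands apart because `0 ^ 0 = 1` adds the term at `x = 0`: this is why zero
coordinates must be distinguished from positive multiples of `q - 1`. -/
theorem MulChar.sum_pow_of_injective {F R : Type*} [Field F] [Fintype F] [CommRing R] [IsDomain R]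
    {χ : MulChar F R} (hχ : Function.Injective χ) (e : ℕ) :
    ∑ x, χ x ^ e = if e = 0 then (Fintype.card F : R)
      else if Fintype.card F - 1 ∣ e then ((Fintype.card F - 1 : ℕ) : R) else 0 := by
  classical
  split_ifs with h0 h1
  · simp [h0]
  · simp_rw [← χ.pow_apply' h0, (MulChar.pow_eq_one_iff_of_injective hχ).2 h1,
      MulChar.sum_one_eq_card_units, Fintype.card_units]
  · simp_rw [← χ.pow_apply' h0]
    exact MulChar.sum_eq_zero_of_ne_one fun h =>
      h1 ((MulChar.pow_eq_one_iff_of_injective hχ).1 h)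

variable {K : Type*} [NormedField K] [IsUltrametricDist K] {F : Type*} [Field F] [Fintype F]
  {p : ℕ} [Fact p.Prime] [CharP F p]

/-- For `ω` the inverse Teichmüller character, the Jacobi sum reduces to `-(a + 1)`, which is
nonzero in characteristic `p`. -/
theorem exists_mulChar_norm_jacobiSum [IsAlgClosed K] [CharZero K] (hpK : ‖(p : K)‖ < 1) :
    ∃ ω : MulChar F K, Function.Injective ω ∧
      ∀ a, a + 1 < Fintype.card F - 1 → ¬ p ∣ a + 1 → ‖jacobiSum (ω ^ a) ω‖ = 1 := by
  obtain ⟨χ, σ, hσ⟩ := exists_teichmuller hpK F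
  refine ⟨χ⁻¹.ringHomComp (unitBallRing K).subtype, fun x y hxy => ?_, fun a ha hpa => ?_⟩
  · have h : χ⁻¹ x = χ⁻¹ y := Subtype.val_injective hxy
    rw [MulChar.inv_apply', MulChar.inv_apply'] at h
    exact inv_injective (σ.injective (by rw [← hσ, ← hσ, h]))
  · let η : MulChar F F := (MulChar.ofUnitHom (MonoidHom.id Fˣ))⁻¹
    have hη : ∀ x, η x = x⁻¹ := by
      intro x
      rw [MulChar.inv_apply']
      by_cases hx : x = 0
      · rw [hx, inv_zero, MulChar.map_zero]
      · exact MulChar.ofUnitHom_coe (MonoidHom.id Fˣ) (Units.mk0 x hx)⁻¹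
    have hcomp : χ⁻¹.ringHomComp (IsLocalRing.residue (unitBallRing K)) = η.ringHomComp σ := by
      ext u
      rw [MulChar.ringHomComp_apply, MulChar.ringHomComp_apply, MulChar.inv_apply', hσ, hη]
    rw [MulChar.ringHomComp_pow, jacobiSum_ringHomComp]
    refine norm_eq_one_of_residue_ne_zero ?_
    rw [← jacobiSum_ringHomComp, ← MulChar.ringHomComp_pow, hcomp, MulChar.ringHomComp_pow,
      jacobiSum_ringHomComp, jacobiSum_inv_pow hη ha, map_ne_zero, neg_ne_zero]
    exact_mod_cast fun h => hpa ((CharP.cast_eq_zero_iff F p (a + 1)).1 (by exact_mod_cast h))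

theorem norm_natCast_card_sub_one (hpK : ‖(p : K)‖ < 1) :
    ‖((Fintype.card F - 1 : ℕ) : K)‖ = 1 := by
  have hp : p.Prime := Fact.out
  obtain ⟨m, hm, hcard⟩ := FiniteField.card F p
  have h1 : ‖((Fintype.card F : ℕ) : K)‖ < 1 := by
    rw [hcard, Nat.cast_pow, norm_pow]
    exact pow_lt_one₀ (norm_nonneg _) hpK m.ne_zero
  rw [Nat.cast_sub Fintype.card_pos, Nat.cast_one, ← norm_neg, neg_sub]
  have := IsUltrametricDist.norm_add_eq_max_of_norm_ne_norm (x := (1 : K))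
    (y := -((Fintype.card F : ℕ) : K)) (by rw [norm_one, norm_neg]; exact h1.ne')
  rw [sub_eq_add_neg, this, norm_one, norm_neg, max_eq_left h1.le]

/-- Multiplicative representatives `T` of a finite field of `q` elements, with functions `h i` dual
to the powers `T ^ i`, `i < q`, such that the coefficients `∑ h i x * ψ x` of the expansion of an
additive character in powers of `T` have known absolute values. -/
theorem exists_dual_powers [IsAlgClosed K] [CharZero K] (hpK : ‖(p : K)‖ < 1) {ρ : ℝ}
    (hρ0 : 0 ≤ ρ) (hρ : ρ ^ (p - 1) = ‖(p : K)‖) :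
    ∃ (T : F →*₀ K) (h : ℕ → F → K), (∀ x, ‖T x‖ ≤ 1) ∧
      (∀ e : ℕ, ∑ x, T x ^ e = if e = 0 then (Fintype.card F : K)
        else if Fintype.card F - 1 ∣ e then ((Fintype.card F - 1 : ℕ) : K) else 0) ∧
      (∀ i x, ‖h i x‖ ≤ 1) ∧
      (∀ i < Fintype.card F, ∀ j < Fintype.card F,
        ∑ x, h i x * T x ^ j = if i = j then 1 else 0) ∧
      ∀ ψ : AddChar F K, ψ ≠ 1 → ∀ i < Fintype.card F,
        ‖∑ x, h i x * ψ x‖ = ρ ^ pWeight p i := by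
  classical
  have hp : p.Prime := Fact.out
  obtain ⟨ω, hω, hJ⟩ := exists_mulChar_norm_jacobiSum (F := F) hpK
  have hω' : Function.Injective (ω⁻¹ : MulChar F K) := fun x y hxy => by
    rw [MulChar.inv_apply', MulChar.inv_apply'] at hxy
    exact inv_injective (hω hxy)
  have hsum := MulChar.sum_pow_of_injective hω'
  have hn1 := norm_natCast_card_sub_one (K := K) (F := F) hpK
  have hq1 := Fintype.one_lt_card (α := F)
  set q := Fintype.card F with hq
  set n := q - 1 with hn
  have hnK : (n : K) ≠ 0 := norm_ne_zero_iff.1 (by rw [hn1]; exact one_ne_zero)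
  have hqK : ‖(q : K)‖ ≤ 1 := IsUltrametricDist.norm_natCast_le_one K q
  -- Orthogonality suggests `ω ^ i / n`, but `T ^ 0` and `T ^ n` agree off `0`. So `h 0` is
  -- evaluation at `0`, and `h n` subtracts `q` times this evaluation to kill `T ^ 0`.
  set h : ℕ → F → K := fun i x =>
    if i = 0 then (if x = 0 then 1 else 0)
    else if i = n then (1 - if x = 0 then (q : K) else 0) / n
    else (ω ^ i) x / n with hdef
  have hh0 : ∀ (i : ℕ) (φ : F → K), i = 0 → ∑ x, h i x * φ x = φ 0 := by
    intro i φ hi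
    simp [hdef, hi]
  have hhn : ∀ (i : ℕ) (φ : F → K), i = n → ∑ x, h i x * φ x = (∑ x, φ x - q * φ 0) / n := by
    intro i φ hi
    have hn0 : n ≠ 0 := by omega
    simp [hdef, hi, hn0, div_mul_eq_mul_div, ← Finset.sum_div, sub_mul]
  have hhi : ∀ (i : ℕ) (φ : F → K), i ≠ 0 → i ≠ n →
      ∑ x, h i x * φ x = (∑ x, (ω ^ i) x * φ x) / n := by
    intro i φ hi hi'
    simp [hdef, hi, hi', div_mul_eq_mul_div, ← Finset.sum_div]
  refine ⟨ω⁻¹.toMonoidWithZeroHom, h, fun x => MulChar.norm_apply_le ω⁻¹ x, hsum, fun i x => ?_,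
    fun i hi j hj => ?_, fun ψ hψ i hi => ?_⟩
  · simp only [hdef]
    split_ifs
    · simp
    · simp
    · rw [norm_div, hn1, div_one]
      rw [sub_eq_add_neg]
      exact (IsUltrametricDist.norm_add_le_max _ _).trans (max_le norm_one.le (by rwa [norm_neg]))
    · rw [norm_div, hn1, div_one, sub_zero, norm_one]
    · rw [norm_div, hn1, div_one]
      exact MulChar.norm_apply_le _ x
  · change ∑ x, h i x * ω⁻¹ x ^ j = _
    by_cases hi0 : i = 0
    · rw [hh0 i _ hi0, MulChar.map_zero, hi0, zero_pow_eq]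
      simp only [eq_comm]
    by_cases hin : i = n
    · rw [hhn i _ hin, hsum, MulChar.map_zero, zero_pow_eq, hin]
      by_cases hj0 : j = 0
      · rw [if_pos hj0, if_pos hj0, if_neg (by omega), mul_one, sub_self, zero_div]
      · rw [if_neg hj0, if_neg hj0, mul_zero, sub_zero]
        by_cases hjn : n = j
        · rw [if_pos (dvd_of_eq hjn), if_pos hjn, div_self hnK]
        · rw [if_neg (Nat.not_dvd_of_pos_of_lt (by omega) (by omega)), if_neg hjn, zero_div]
    -- The exponent lies strictly between `0` and `2n`, so it is divisible by `n` only when `i = j`.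
    · have e : ∀ x, (ω ^ i) x * ω⁻¹ x ^ j = ω⁻¹ x ^ (n - i + j) := by
        intro x
        by_cases hx : x = 0
        · rw [hx, MulChar.map_zero, MulChar.map_zero, zero_mul, zero_pow (by omega)]
        · obtain ⟨u, rfl⟩ := Ne.isUnit hx
          have h1 : ω u * ω⁻¹ u = 1 := by
            rw [← MulChar.mul_apply, mul_inv_cancel, MulChar.one_apply_coe]
          have h2 : ω⁻¹ u ^ n = 1 := by
            rw [← map_pow, FiniteField.pow_card_sub_one_eq_one _ u.ne_zero, MulChar.map_one]
          rw [MulChar.pow_apply_coe, pow_add]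
          congr 1
          calc ω u ^ i = ω u ^ i * ω⁻¹ u ^ (i + (n - i)) := by
                rw [show i + (n - i) = n by omega, h2, mul_one]
            _ = (ω u * ω⁻¹ u) ^ i * ω⁻¹ u ^ (n - i) := by rw [pow_add, mul_pow, mul_assoc]
            _ = ω⁻¹ u ^ (n - i) := by rw [h1, one_pow, one_mul]
      rw [hhi i _ hi0 hin, sum_congr rfl fun x _ => e x, hsum, if_neg (by omega)]
      by_cases hij : i = j
      · rw [if_pos (dvd_of_eq (by omega)), if_pos hij, div_self hnK]
      · have hnd : ¬ n ∣ n - i + j := by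
          rintro ⟨c, hc⟩
          rcases c with _ | _ | c
          · omega
          · omega
          · have : n * (c + 1 + 1) = n * c + n + n := by ring
            omega
        rw [if_neg hnd, if_neg hij, zero_div]
  · by_cases hi0 : i = 0
    · rw [hh0 i _ hi0, AddChar.map_zero_eq_one, norm_one, hi0, pWeight_zero, pow_zero]
    by_cases hin : i = n
    · obtain ⟨m, hm, hcard⟩ := FiniteField.card F p
      rw [hhn i _ hin, AddChar.sum_eq_zero_of_ne_one hψ, AddChar.map_zero_eq_one, mul_one, zero_sub,
        norm_div, hn1, div_one, norm_neg, hin, hn, hq, hcard, Nat.cast_pow, norm_pow,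
        pWeight_pow_sub_one hp.one_lt, ← hρ, ← pow_mul, mul_comm]
    · rw [hhi i _ hi0 hin, norm_div, hn1, div_one]
      exact norm_gaussSum_pow_eq_pow_pWeight hρ0 hρ hω hJ hψ (by omega)

end Dual

/-! ### Exponential sums as polynomials in the `T (a_d)` -/

section Expansion

open Finset

/-- Duality says that one square matrix is a left inverse of another, hence also a right inverse. -/
theorem eq_sum_dual_mul_pow {K F : Type*} [Field K] [Fintype F] {T : F → K} {h : ℕ → F → K}
    (hdual : ∀ i < Fintype.card F, ∀ j < Fintype.card F,
      ∑ x, h i x * T x ^ j = if i = j then 1 else 0) (φ : F → K) (x : F) :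
    φ x = ∑ i ∈ range (Fintype.card F), (∑ y, h i y * φ y) * T x ^ i := by
  classical
  let H : Matrix (Fin (Fintype.card F)) F K := Matrix.of fun i x => h i x
  let V : Matrix F (Fin (Fintype.card F)) K := Matrix.of fun x j => T x ^ (j : ℕ)
  have hHV : H * V = 1 := by
    ext i j
    rw [Matrix.mul_apply, Matrix.one_apply]
    simpa [H, V, Fin.ext_iff] using hdual i i.2 j j.2
  have hVH : V * H = 1 := (Matrix.mul_eq_one_comm_of_equiv (Fintype.equivFin F).symm).1 hHV
  have h1 : φ x = ((V * H).mulVec φ) x := by rw [hVH, Matrix.one_mulVec]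
  rw [h1, ← Matrix.mulVec_mulVec, Finset.sum_range]
  simp only [Matrix.mulVec, dotProduct, H, V, Matrix.of_apply]
  exact sum_congr rfl fun i _ => mul_comm _ _

variable {K : Type*} [Field K] {F : Type*} [Field F] [Fintype F] {r : ℕ}

theorem AddChar.map_sum_eq_prod {A M ι : Type*} [AddCommMonoid A] [CommMonoid M]
    (ψ : AddChar A M) (s : Finset ι) (f : ι → A) : ψ (∑ i ∈ s, f i) = ∏ i ∈ s, ψ (f i) := by
  classical
  induction s using Finset.induction_on with
  | empty => simp
  | insert i s hi ih => rw [sum_insert hi, prod_insert hi, AddChar.map_add_eq_mul, ih]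

/-- The coefficient of `∏ T (a_d) ^ u_d` in the exponential sum of `∑ a_d x ^ d`, where `c i` are
the coefficients of the expansion of the additive character in powers of `T`. -/
def expSumCoeff (T : F → K) (c : ℕ → K) (D : Finset (Fin r →₀ ℕ)) (u : D → ℕ) : K :=
  (∏ d, c (u d)) * ∏ j : Fin r, ∑ t, T t ^ ∑ d, u d * (d : Fin r →₀ ℕ) j

theorem expSum_eq_sum_expSumCoeff (T : F →*₀ K) (c : ℕ → K) {ψ : AddChar F K}
    (hψ : ∀ x, ψ x = ∑ i ∈ range (Fintype.card F), c i * T x ^ i)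
    (D : Finset (Fin r →₀ ℕ)) (a : D → F) :
    expSum ψ (∑ d : D, MvPolynomial.monomial (d : Fin r →₀ ℕ) (a d)) =
      ∑ u ∈ Fintype.piFinset fun _ : D => range (Fintype.card F),
        expSumCoeff T c D u * ∏ d, T (a d) ^ u d := by
  have hx : ∀ x : Fin r → F,
      ψ (MvPolynomial.eval x (∑ d : D, MvPolynomial.monomial (d : Fin r →₀ ℕ) (a d))) =
      ∑ u ∈ Fintype.piFinset fun _ : D => range (Fintype.card F),
        (∏ d, c (u d)) * (∏ d, T (a d) ^ u d) *
          ∏ j : Fin r, T (x j) ^ ∑ d, u d * (d : Fin r →₀ ℕ) j := by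
    intro x
    rw [map_sum, AddChar.map_sum_eq_prod]
    simp_rw [hψ]
    rw [prod_univ_sum]
    refine sum_congr rfl fun u _ => ?_
    rw [prod_mul_distrib, mul_assoc]
    congr 1
    simp_rw [← prod_pow_eq_pow_sum]
    rw [prod_comm, ← prod_mul_distrib]
    refine prod_congr rfl fun d _ => ?_
    rw [MvPolynomial.eval_monomial, Finsupp.prod_fintype _ _ (fun _ => pow_zero _), map_mul,
      map_prod, mul_pow, ← prod_pow]
    congr 1
    refine prod_congr rfl fun j _ => ?_
    rw [map_pow, ← pow_mul, mul_comm]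
  unfold expSum expSumCoeff
  simp_rw [hx]
  rw [sum_comm]
  refine sum_congr rfl fun u _ => ?_
  rw [← mul_sum, prod_univ_sum, Fintype.piFinset_univ]
  ring

/-- Pairing with the dual functions in each variable `a_d` extracts a single coefficient; sharpness
rests on this inversion. -/
theorem expSumCoeff_eq_sum {T : F →*₀ K} {h : ℕ → F → K}
    (hdual : ∀ i < Fintype.card F, ∀ j < Fintype.card F,
      ∑ x, h i x * T x ^ j = if i = j then 1 else 0) (c : ℕ → K) {ψ : AddChar F K}
    (hψ : ∀ x, ψ x = ∑ i ∈ range (Fintype.card F), c i * T x ^ i)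
    (D : Finset (Fin r →₀ ℕ)) {u : D → ℕ} (hu : ∀ d, u d < Fintype.card F) :
    expSumCoeff T c D u = ∑ a : D → F, (∏ d, h (u d) (a d)) *
      expSum ψ (∑ d : D, MvPolynomial.monomial (d : Fin r →₀ ℕ) (a d)) := by
  classical
  simp_rw [expSum_eq_sum_expSumCoeff T c hψ, mul_sum]
  rw [sum_comm]
  have key : ∀ v ∈ Fintype.piFinset fun _ : D => range (Fintype.card F),
      ∑ a : D → F, (∏ d, h (u d) (a d)) * (expSumCoeff T c D v * ∏ d, T (a d) ^ v d) =
      if v = u then expSumCoeff T c D v else 0 := by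
    intro v hv
    have e : ∀ a : D → F, (∏ d, h (u d) (a d)) * (expSumCoeff T c D v * ∏ d, T (a d) ^ v d) =
        expSumCoeff T c D v * ∏ d, (h (u d) (a d) * T (a d) ^ v d) := fun a => by
      rw [prod_mul_distrib]
      ring
    have e2 := prod_univ_sum (fun _ : D => (univ : Finset F)) (fun d t => h (u d) t * T t ^ v d)
    rw [Fintype.piFinset_univ] at e2
    rw [sum_congr rfl fun a _ => e a, ← mul_sum, ← e2,
      prod_congr rfl fun d _ => hdual (u d) (hu d) (v d)
        (mem_range.1 (Fintype.mem_piFinset.1 hv d))]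
    by_cases hvu : v = u
    · simp [hvu]
    · obtain ⟨d, hd⟩ := Function.ne_iff.1 hvu
      rw [if_neg hvu, prod_eq_zero (mem_univ d) (if_neg (Ne.symm hd)), mul_zero]
  rw [sum_congr rfl key, sum_ite_eq', if_pos]
  exact Fintype.mem_piFinset.2 fun d => mem_range.2 (hu d)

end Expansion

/-! ### The sharp bound over a fixed field -/

section Bounds

open Finset

variable {K : Type*} [NormedField K] [IsUltrametricDist K] {F : Type*} [Field F] [Fintype F]
  {p r : ℕ} [Fact p.Prime] [CharP F p]

theorem norm_expSumCoeff_of_dvd {T : F → K} {c : ℕ → K} {ρ : ℝ} {m : ℕ}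
    (hcard : Fintype.card F = p ^ m) (hpK : ‖(p : K)‖ < 1)
    (hρ : ρ ^ (p - 1) = ‖(p : K)‖)
    (hT : ∀ e : ℕ, ∑ x, T x ^ e = if e = 0 then (Fintype.card F : K)
        else if Fintype.card F - 1 ∣ e then ((Fintype.card F - 1 : ℕ) : K) else 0)
    (hc : ∀ i < Fintype.card F, ‖c i‖ = ρ ^ pWeight p i)
    {D : Finset (Fin r →₀ ℕ)} {u : D → ℕ} (hu : ∀ d, u d < Fintype.card F)
    (hdvd : ∀ j : Fin r, p ^ m - 1 ∣ ∑ d, u d * (d : Fin r →₀ ℕ) j) :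
    ‖expSumCoeff T c D u‖ = ρ ^ (∑ d, pWeight p (u d) + m * (p - 1) *
      (univ.filter fun j : Fin r => ∑ d, u d * (d : Fin r →₀ ℕ) j = 0).card) := by
  have hj : ∀ j : Fin r, ‖∑ t, T t ^ ∑ d, u d * (d : Fin r →₀ ℕ) j‖ =
      if ∑ d, u d * (d : Fin r →₀ ℕ) j = 0 then ρ ^ (m * (p - 1)) else 1 := by
    intro j
    rw [hT]
    split_ifs with h1 h2
    · rw [hcard, Nat.cast_pow, norm_pow, ← hρ, ← pow_mul, mul_comm]
    · exact norm_natCast_card_sub_one hpK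
    · exact absurd (hcard ▸ hdvd j) h2
  rw [expSumCoeff, norm_mul, norm_prod, norm_prod, prod_congr rfl fun d _ => hc _ (hu d),
    prod_pow_eq_pow_sum, prod_congr rfl fun j _ => hj j, prod_ite, prod_const, prod_const_one,
    mul_one, ← pow_mul, ← pow_add]

/-- Each zero coordinate contributes a factor `q` of norm `ρ ^ (m * (p - 1))`, exactly the price
paid in `minWeight_le_add`. -/
theorem norm_expSumCoeff_le {T : F → K} {c : ℕ → K} {ρ : ℝ} {m : ℕ} (hr : 0 < r) (hm : 1 ≤ m)
    (hcard : Fintype.card F = p ^ m) (hpK : ‖(p : K)‖ < 1) (hρ0 : 0 ≤ ρ) (hρ1 : ρ ≤ 1)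
    (hρ : ρ ^ (p - 1) = ‖(p : K)‖)
    (hT : ∀ e : ℕ, ∑ x, T x ^ e = if e = 0 then (Fintype.card F : K)
        else if Fintype.card F - 1 ∣ e then ((Fintype.card F - 1 : ℕ) : K) else 0)
    (hc : ∀ i < Fintype.card F, ‖c i‖ = ρ ^ pWeight p i)
    {D : Finset (Fin r →₀ ℕ)} (hD : ∀ j : Fin r, ∃ d ∈ D, d j ≠ 0)
    {u : D → ℕ} (hu : ∀ d, u d < Fintype.card F) :
    ‖expSumCoeff T c D u‖ ≤ ρ ^ minWeight p D m := by
  by_cases hdvd : ∀ j : Fin r, p ^ m - 1 ∣ ∑ d, u d * (d : Fin r →₀ ℕ) j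
  · rw [norm_expSumCoeff_of_dvd hcard hpK hρ hT hc hu hdvd]
    exact pow_le_pow_of_le_one hρ0 hρ1 (minWeight_le_add Fact.out hr hD hm
      (fun d => Nat.le_sub_one_of_lt (hcard ▸ hu d)) hdvd)
  · push Not at hdvd
    obtain ⟨j, hj⟩ := hdvd
    have h0 : ∑ t, T t ^ ∑ d, u d * (d : Fin r →₀ ℕ) j = 0 := by
      rw [hT, if_neg fun h : ∑ d, u d * (d : Fin r →₀ ℕ) j = 0 => hj (h ▸ dvd_zero _), if_neg (hcard ▸ hj)]
    rw [expSumCoeff, prod_eq_zero (mem_univ j) h0, mul_zero, norm_zero]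
    positivity

/-- The absolute values of the exponential sums over `F` of the polynomials with exponents in `D`
are at most `ρ ^ σ_p(D, m)`, and this bound is attained. -/
theorem norm_expSum_le_and_exists_eq [IsAlgClosed K] [CharZero K] {ρ : ℝ} {m : ℕ} (hr : 0 < r)
    (hm : 1 ≤ m) (hcard : Fintype.card F = p ^ m) (hpK : ‖(p : K)‖ < 1) (hρ0 : 0 < ρ)
    (hρ1 : ρ ≤ 1) (hρ : ρ ^ (p - 1) = ‖(p : K)‖)
    {D : Finset (Fin r →₀ ℕ)} (hD : ∀ j : Fin r, ∃ d ∈ D, d j ≠ 0)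
    {ψ : AddChar F K} (hψ : ψ ≠ 1) :
    (∀ a : D → F, ‖expSum ψ (∑ d : D, MvPolynomial.monomial (d : Fin r →₀ ℕ) (a d))‖ ≤
      ρ ^ minWeight p D m) ∧
    ∃ a : D → F, ‖expSum ψ (∑ d : D, MvPolynomial.monomial (d : Fin r →₀ ℕ) (a d))‖ =
      ρ ^ minWeight p D m := by
  have hp : p.Prime := Fact.out
  obtain ⟨T, h, hT1, hT, hh, hdual, hc⟩ := exists_dual_powers (F := F) hpK hρ0.le hρ
  set c : ℕ → K := fun i => ∑ x, h i x * ψ x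
  have hexp : ∀ x, ψ x = ∑ i ∈ range (Fintype.card F), c i * T x ^ i :=
    eq_sum_dual_mul_pow hdual ψ
  have hle : ∀ a : D → F, ‖expSum ψ (∑ d : D, MvPolynomial.monomial (d : Fin r →₀ ℕ) (a d))‖ ≤
      ρ ^ minWeight p D m := by
    intro a
    rw [expSum_eq_sum_expSumCoeff T c hexp]
    refine IsUltrametricDist.norm_sum_le_of_forall_le_of_nonneg (by positivity) fun u hu => ?_
    have hu' : ∀ d, u d < Fintype.card F := fun d => mem_range.1 (Fintype.mem_piFinset.1 hu d)
    rw [norm_mul, norm_prod]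
    refine (mul_le_of_le_one_right (norm_nonneg _) (prod_le_one (fun _ _ => norm_nonneg _)
      fun d _ => ?_)).trans (norm_expSumCoeff_le hr hm hcard hpK hρ0.le hρ1 hρ hT (hc ψ hψ) hD hu')
    rw [norm_pow]
    exact pow_le_one₀ (norm_nonneg _) (hT1 _)
  refine ⟨hle, ?_⟩
  -- If all sums were strictly smaller, so would be the coefficient at a minimal `u`; but its norm
  -- is exactly the bound, as `u` has no zero coordinate.
  by_contra! hne
  have hlt := fun a => lt_of_le_of_ne (hle a) (hne a)
  obtain ⟨u, hu, hw⟩ := exists_weight_eq_minWeight hp hr hD hm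
  have hu' : ∀ d, u d < Fintype.card F := fun d => by
    have h1 := hu.1 d
    have h2 : 0 < p ^ m := Nat.pow_pos hp.pos
    rw [hcard]
    omega
  have hnorm : ‖expSumCoeff T c D u‖ = ρ ^ minWeight p D m := by
    rw [norm_expSumCoeff_of_dvd hcard hpK hρ hT (hc ψ hψ) hu'
      fun j => (Nat.modEq_zero_iff_dvd).1 (hu.2.2.1 j), hw,
      filter_eq_empty_iff.2 fun j _ => (hu.2.2.2 j).ne', card_empty, mul_zero, add_zero]
  rw [expSumCoeff_eq_sum hdual c hexp D hu'] at hnorm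
  obtain ⟨a, -, ha⟩ := IsUltrametricDist.exists_norm_finsetSum_le (univ : Finset (D → F))
    (fun a => (∏ d, h (u d) (a d)) *
      expSum ψ (∑ d : D, MvPolynomial.monomial (d : Fin r →₀ ℕ) (a d)))
  rw [hnorm, norm_mul, norm_prod] at ha
  exact absurd (ha.trans (mul_le_of_le_one_left (norm_nonneg _)
    (prod_le_one (fun _ _ => norm_nonneg _) fun d _ => hh _ _))) (not_le.2 (hlt a))

end Bounds

/-! ### Passage to valuations on `ℂ_[p]` -/

theorem PadicComplex.norm_natCast_p (p : ℕ) [Fact p.Prime] :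
    ‖(p : PadicComplex p)‖ = (p : ℝ)⁻¹ := by
  rw [← map_natCast (algebraMap ℚ_[p] (PadicComplex p)), norm_algebraMap', Padic.norm_p]

theorem neg_logb_rpow_pow {p m w : ℕ} (hp : 1 < p) (hm : 1 ≤ m) :
    -Real.logb ((p ^ m : ℕ) : ℝ) (((p : ℝ) ^ (-(1 / ((p : ℝ) - 1)))) ^ w) =
      1 / ((p : ℝ) - 1) * ((w : ℝ) / m) := by
  have hp1 : (1 : ℝ) < p := by exact_mod_cast hp
  have hlog : Real.log p ≠ 0 := (Real.log_pos hp1).ne'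
  have hm0 : (m : ℝ) ≠ 0 := by exact_mod_cast (by omega : m ≠ 0)
  have h1 : (p : ℝ) - 1 ≠ 0 := by linarith
  rw [Real.logb, Real.log_pow, Real.log_rpow (by linarith), Nat.cast_pow, Real.log_pow]
  field_simp

theorem mainTheorem1 (p : ℕ) [Fact p.Prime] (r : ℕ) (hr : 0 < r) :
    (∀ (F : Type*) [Field F] [Fintype F] [CharP F p] (f : MvPolynomial (Fin r) F),
      (∀ j : Fin r, j ∈ f.vars) →
      ∀ ψ : AddChar F (PadicComplex p), ψ ≠ 1 →
        (pDensity p f.support : WithTop ℝ) ≤ qAdicVal (Fintype.card F) (expSum ψ f)) ∧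
    (∀ D : Finset (Fin r →₀ ℕ), (∀ j : Fin r, ∃ d ∈ D, d j ≠ 0) →
      ∃ m : ℕ, 1 ≤ m ∧
        ∀ (F : Type*) [Field F] [Fintype F], Fintype.card F = p ^ m →
          ∀ ψ : AddChar F (PadicComplex p), ψ ≠ 1 →
            ∃ f : MvPolynomial (Fin r) F, f.support ⊆ D ∧
              qAdicVal (p ^ m) (expSum ψ f) = (pDensity p D : WithTop ℝ)) := by
  have hp : p.Prime := Fact.out
  have hp1 : (1 : ℝ) < p := by exact_mod_cast hp.one_lt
  have hpK : ‖(p : PadicComplex p)‖ < 1 := by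
    rw [PadicComplex.norm_natCast_p]
    exact inv_lt_one_of_one_lt₀ hp1
  set ρ : ℝ := (p : ℝ) ^ (-(1 / ((p : ℝ) - 1))) with hρdef
  have hρ0 : 0 < ρ := Real.rpow_pos_of_pos (by linarith) _
  have hρ1 : ρ ≤ 1 := Real.rpow_le_one_of_one_le_of_nonpos hp1.le
    (neg_nonpos.2 (one_div_nonneg.2 (by linarith)))
  have hρ : ρ ^ (p - 1) = ‖(p : PadicComplex p)‖ := by
    have h1 : (p : ℝ) - 1 ≠ 0 := by linarith
    rw [PadicComplex.norm_natCast_p, hρdef, ← Real.rpow_mul_natCast (by linarith),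
      Nat.cast_sub hp.one_le, Nat.cast_one, neg_mul, one_div_mul_cancel h1,
      Real.rpow_neg_one]
  constructor
  · intro F _ _ _ f hf ψ hψ
    obtain ⟨m, hm, hcard⟩ := FiniteField.card F p
    have hD : ∀ j : Fin r, ∃ d ∈ f.support, d j ≠ 0 := fun j => by
      obtain ⟨d, hd, hj⟩ := (MvPolynomial.mem_vars_iff_mem_support j).1 (hf j)
      exact ⟨d, hd, Finsupp.mem_support_iff.1 hj⟩
    have hle := (norm_expSum_le_and_exists_eq hr m.pos hcard hpK hρ0 hρ1 hρ hD hψ).1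
      fun d => f.coeff d
    rw [Finset.sum_coe_sort f.support fun d => MvPolynomial.monomial d (f.coeff d),
      MvPolynomial.support_sum_monomial_coeff] at hle
    unfold qAdicVal
    split_ifs with h0
    · exact le_top
    refine WithTop.coe_le_coe.2 ((pDensity_le hp m.pos).trans ?_)
    rw [← neg_logb_rpow_pow hp.one_lt m.pos, hcard, neg_le_neg_iff]
    exact Real.logb_le_logb_of_le (by exact_mod_cast Nat.one_lt_pow m.ne_zero hp.one_lt)
      (norm_pos_iff.2 h0) hle
  · intro D hD
    -- An `m` attaining the density serves all `F` and `ψ` at once, since the bound over a fixed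
    -- field is sharp for every nontrivial `ψ`.
    obtain ⟨m, hm, hmin⟩ := exists_pDensity_eq hp hr hD
    refine ⟨m, hm, fun F _ _ hcard ψ hψ => ?_⟩
    have : CharP F p := charP_of_card_eq_prime_pow hcard
    obtain ⟨a, ha⟩ := (norm_expSum_le_and_exists_eq hr hm hcard hpK hρ0 hρ1 hρ hD hψ).2
    refine ⟨∑ d : D, MvPolynomial.monomial (d : Fin r →₀ ℕ) (a d), ?_, ?_⟩
    · classical
      refine MvPolynomial.support_sum.trans (Finset.biUnion_subset.2 fun d _ => ?_)
      exact MvPolynomial.support_monomial_subset.trans (Finset.singleton_subset_iff.2 d.2)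
    · have h0 : expSum ψ (∑ d : D, MvPolynomial.monomial (d : Fin r →₀ ℕ) (a d)) ≠ 0 := by
        rw [← norm_ne_zero_iff, ha]
        positivity
      rw [qAdicVal, if_neg h0, ha, hmin, neg_logb_rpow_pow hp.one_lt hm]
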